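/- Let $P_0(\xi)=\sum_{|\alpha|\le m}a_\alpha\xi^\alpha$ be a polynomial on $\mathbb{R}^n$ of degree $m\ge 2$ with real coefficients, and let $P_0=P_0(D)=\sum_{|\alpha|\le m} a_\alpha D^\alpha$, $D_j=-i\,\partial/\partial x_j$. Let $\Omega\subset\mathbb{R}^n$ be a bounded domain and let $V\in L^\infty(\mathbb{R}^n)$ be real-valued with $\operatorname{supp} V=\overline\Omega$ and $V\ge\delta>0$ a.e. in $\overline\Omega$ for some constant $\delta$. Let $H^{P_0}_0(\Omega)$ be the completion of $C_0^\infty(\Omega)$ with respect to the norm $\|P_0(D)\varphi\|_{L^2}$, regarded as a subspace of $L^2(\Omega)$ (it consists of the $L^2(\Omega)$-limits of sequences in $C_0^\infty(\Omega)$ that are Cauchy for this norm). A number $\lambda\in\mathbb{C}$ is called a transmission eigenvalue if there exist $0\ne v\in L^2_{\mathrm{loc}}(\Omega)$ and $0\ne w\in L^2_{\mathrm{loc}}(\Omega)$ such that $$(P_0-\lambda)v=0\ \text{ in }\Omega,\qquad (P_0-\lambda(1+V))w=0\ \text{ in }\Omega,\qquad v-w\in H^{P_0}_0(\Omega),$$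 the equations being understood in the sense of distributions. Put $$\widetilde P_0(\xi)=\Big(\sum_{\alpha}|\partial^\alpha P_0(\xi)|^2\Big)^{1/2},$$ the sum being over all multi-indices $\alpha\in\mathbb{N}^n$. Theorem. If $\widetilde P_0(\xi)\to\infty$ as $|\xi|\to\infty$, then the set of transmission eigenvalues is discrete, i.e. it is a closed discrete subset of $\mathbb{C}$ (it has no accumulation point in $\mathbb{C}$). -/

import Mathlib

open MeasureTheory TopologicalSpace Filter Topology
open scoped Distributions LineDeriv ENNReal

noncomputable section

namespace Acoustic

/-- Euclidean space `ℝⁿ`. -/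
abbrev Space (n : ℕ) : Type := EuclideanSpace ℝ (Fin n)

variable {n : ℕ} {Ω : Opens (Space n)}

/-- `D_j = -i ∂/∂x_j` on test functions on `Ω`. -/
def D (j : Fin n) (φ : 𝓓(Ω, ℂ)) : 𝓓(Ω, ℂ) :=
  (-Complex.I) • ∂_{EuclideanSpace.single j (1 : ℝ)} φ

/-- `D^α = D_1^{α_1} ⋯ D_n^{α_n}` on test functions. -/
def multiD (α : Fin n →₀ ℕ) (φ : 𝓓(Ω, ℂ)) : 𝓓(Ω, ℂ) :=
  (List.finRange n).foldr (fun j ψ => (D j)^[α j] ψ) φ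

/-- `P(D) φ = ∑_α a_α D^α φ`, where `P(ξ) = ∑_α a_α ξ^α` has real coefficients. -/
def diffOp (P : MvPolynomial (Fin n) ℝ) (φ : 𝓓(Ω, ℂ)) : 𝓓(Ω, ℂ) :=
  ∑ α ∈ P.support, ((P.coeff α : ℝ) : ℂ) • multiD α φ

/-- The formal transpose `P(-D) φ = ∑_α (-1)^{|α|} a_α D^α φ`, so that the distribution `P(D) u`
is `φ ↦ ⟨u, P(-D) φ⟩`. -/
def diffOpTranspose (P : MvPolynomial (Fin n) ℝ) (φ : 𝓓(Ω, ℂ)) : 𝓓(Ω, ℂ) :=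
  ∑ α ∈ P.support, ((-1 : ℂ) ^ α.degree * ((P.coeff α : ℝ) : ℂ)) • multiD α φ

/-- The partial derivative `∂^α P` of a polynomial. -/
def multiPderiv (α : Fin n → ℕ) (P : MvPolynomial (Fin n) ℝ) : MvPolynomial (Fin n) ℝ :=
  (List.finRange n).foldr (fun j Q => (MvPolynomial.pderiv j)^[α j] Q) P

/-- `P̃(ξ) = (∑_α |∂^α P(ξ)|²)^{1/2}`. The sum is over all multi-indices; it is written over those
with all `α_j ≤ deg P`, because `∂^α P = 0` for the others. -/
def symbolTilde (P : MvPolynomial (Fin n) ℝ) (ξ : Space n) : ℝ :=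
  Real.sqrt (∑ α : Fin n → Fin (P.totalDegree + 1),
    (MvPolynomial.eval (fun j => ξ j) (multiPderiv (fun j => (α j : ℕ)) P)) ^ 2)

/-- `u ∈ L²_loc(Ω)`. -/
def MemL2Loc (Ω : Opens (Space n)) (u : Space n → ℂ) : Prop :=
  ∀ K : Set (Space n), IsCompact K → K ⊆ Ω → MemLp u 2 (volume.restrict K)

/-- `u ∈ H^P_0(Ω)`: the completion of `C_0^∞(Ω)` for the norm `‖P(D)φ‖_{L²}`, realized as a space
of functions in `L²(Ω)`: the `L²(Ω)`-limits of sequences in `C_0^∞(Ω)` which are Cauchy for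
this norm. The realization is possible because `‖φ‖_{L²} ≤ C ‖P(D)φ‖_{L²}` on `C_0^∞(Ω)` for
bounded `Ω` and `P ≠ 0`, and because `P(D)` is closable in `L²(Ω)`. -/
def MemH0 (P : MvPolynomial (Fin n) ℝ) (Ω : Opens (Space n)) (u : Space n → ℂ) : Prop :=
  MemLp u 2 (volume.restrict (Ω : Set (Space n))) ∧
  ∃ φ : ℕ → 𝓓(Ω, ℂ),
    Tendsto (fun p : ℕ × ℕ => eLpNorm (diffOp P (φ p.1 - φ p.2)) 2 volume) atTop (𝓝 0) ∧
    Tendsto (fun k => eLpNorm (fun x => φ k x - u x) 2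
      (volume.restrict (Ω : Set (Space n)))) atTop (𝓝 0)

/-- `(P(D) - λ q) u = 0` in `𝒟'(Ω)`, for `u ∈ L²_loc(Ω)` and a bounded real function `q`. -/
def WeakSolution (P : MvPolynomial (Fin n) ℝ) (Ω : Opens (Space n)) (lam : ℂ)
    (q : Space n → ℝ) (u : Space n → ℂ) : Prop :=
  ∀ φ : 𝓓(Ω, ℂ),
    ∫ x in (Ω : Set (Space n)), u x * (diffOpTranspose P φ x - lam * (q x : ℂ) * φ x) = 0

/-- `λ` is a transmission eigenvalue: there are `v, w ∈ L²_loc(Ω)`, neither zero, with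
`(P(D) - λ) v = 0` and `(P(D) - λ (1 + V)) w = 0` in `Ω` and `v - w ∈ H^P_0(Ω)`. -/
def IsTransmissionEigenvalue (P : MvPolynomial (Fin n) ℝ) (Ω : Opens (Space n))
    (V : Space n → ℝ) (lam : ℂ) : Prop :=
  ∃ v w : Space n → ℂ,
    MemL2Loc Ω v ∧ MemL2Loc Ω w ∧
    ¬ (v =ᵐ[volume.restrict (Ω : Set (Space n))] 0) ∧
    ¬ (w =ᵐ[volume.restrict (Ω : Set (Space n))] 0) ∧
    WeakSolution P Ω lam (fun _ => 1) v ∧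
    WeakSolution P Ω lam (fun x => 1 + V x) w ∧
    MemH0 P Ω (v - w)

/-- The support of a (class of a) function `V`: the complement of the largest open set on which
`V = 0` almost everywhere. -/
def essSupport (V : Space n → ℝ) : Set (Space n) :=
  (volume.withDensity fun x => ‖V x‖ₑ).support

end Acoustic

end

/-!
The difference `u = v - w` satisfies `(P₀ - λ) u = -λ V w`, and hence
`(P₀ - λ(1 + V)) V⁻¹ (P₀ - λ) u = 0`. The minimal operator of `P₀(D)` has closed range `R ⊆ L²(Ω)`
and a bounded inverse `T` on `R`. In terms of `f = P₀ u`, with `J` the inclusion of `R` in `L²(Ω)`,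
the equation becomes `(J* - λ T* (1 + V)) V⁻¹ (J - λ T) f = 0`. This is a quadratic pencil in `λ`
whose value `J* V⁻¹ J` at `λ = 0` is invertible, because `V⁻¹` is bounded below. Hörmander's
inequality `‖(∂^α P₀)(D)φ‖ ≤ C ‖P₀(D)φ‖` on `C_0^∞(Ω)`, together with `P̃₀ → ∞`, shows that `T` is
compact. Hence the pencil is a compact perturbation of an invertible operator, and linearising it
shows that each disc contains only finitely many eigenvalues.
-/

noncomputable section

namespace Acoustic

/-! ### Completely continuous operators and quadratic pencils -/

section CompletelyContinuous

variable {𝕜 E F G H : Type*} [RCLike 𝕜]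
  [NormedAddCommGroup E] [InnerProductSpace 𝕜 E] [NormedAddCommGroup F] [InnerProductSpace 𝕜 F]
  [NormedAddCommGroup G] [InnerProductSpace 𝕜 G] [NormedAddCommGroup H] [InnerProductSpace 𝕜 H]

open scoped InnerProductSpace

variable (𝕜) in
/-- The sequence `x` tends to zero weakly. -/
def WeaklyNull (x : ℕ → E) : Prop :=
  ∀ y : E, Tendsto (fun k => ⟪y, x k⟫_𝕜) atTop (𝓝 0)

/-- `T` maps weakly null sequences to norm null sequences. Between Hilbert spaces this is
equivalent to compactness; it is the form of compactness which can be checked on the dense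
subspace of test functions. -/
def CompletelyContinuous (T : E →L[𝕜] F) : Prop :=
  ∀ x : ℕ → E, WeaklyNull 𝕜 x → Tendsto (fun k => T (x k)) atTop (𝓝 0)

theorem WeaklyNull.map [CompleteSpace E] [CompleteSpace F] {x : ℕ → E} (hx : WeaklyNull 𝕜 x)
    (T : E →L[𝕜] F) : WeaklyNull 𝕜 fun k => T (x k) := fun y => by
  simpa only [ContinuousLinearMap.adjoint_inner_left] using hx (ContinuousLinearMap.adjoint T y)

theorem WeaklyNull.exists_norm_le [CompleteSpace E] {x : ℕ → E} (hx : WeaklyNull 𝕜 x) :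
    ∃ C, ∀ k, ‖x k‖ ≤ C := by
  obtain ⟨C, hC⟩ := banach_steinhaus (g := fun k => innerSL 𝕜 (x k)) fun y => by
    obtain ⟨B, hB⟩ := (hx y).norm.bddAbove_range
    exact ⟨B, fun k => by simpa only [innerSL_apply_apply, norm_inner_symm] using hB ⟨k, rfl⟩⟩
  exact ⟨C, fun k => by simpa only [innerSL_apply_norm] using hC k⟩

theorem WeaklyNull.add_tendsto_zero {x z : ℕ → E} (hx : WeaklyNull 𝕜 x)
    (hz : Tendsto z atTop (𝓝 0)) : WeaklyNull 𝕜 (x + z) := fun y => by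
  simpa only [Pi.add_apply, inner_add_right, inner_zero_right, add_zero] using
    (hx y).add ((tendsto_const_nhds (x := y)).inner (𝕜 := 𝕜) hz)

theorem weaklyNull_of_orthonormal {e : ℕ → E} (he : Orthonormal 𝕜 e) : WeaklyNull 𝕜 e := by
  intro y
  have hsq := (he.inner_products_summable y).tendsto_atTop_zero.sqrt
  rw [tendsto_zero_iff_norm_tendsto_zero]
  simpa only [Real.sqrt_sq (norm_nonneg _), Real.sqrt_zero, norm_inner_symm] using hsq

namespace CompletelyContinuous

theorem comp_left {S : E →L[𝕜] F} (hS : CompletelyContinuous S) (T : F →L[𝕜] G) :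
    CompletelyContinuous (T ∘L S) := fun x hx => by
  simpa only [map_zero] using! (T.continuous.tendsto 0).comp (hS x hx)

theorem comp_right [CompleteSpace E] [CompleteSpace F] {T : F →L[𝕜] G}
    (hT : CompletelyContinuous T) (S : E →L[𝕜] F) : CompletelyContinuous (T ∘L S) :=
  fun _ hx => hT _ (hx.map S)

theorem add {S T : E →L[𝕜] F} (hS : CompletelyContinuous S) (hT : CompletelyContinuous T) :
    CompletelyContinuous (S + T) := fun x hx => by
  simpa only [add_zero] using! (hS x hx).add (hT x hx)

theorem neg {T : E →L[𝕜] F} (hT : CompletelyContinuous T) : CompletelyContinuous (-T) :=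
  fun x hx => by simpa only [neg_zero] using! (hT x hx).neg

theorem adjoint [CompleteSpace E] [CompleteSpace F] {T : E →L[𝕜] F}
    (hT : CompletelyContinuous T) : CompletelyContinuous (ContinuousLinearMap.adjoint T) := by
  intro x hx
  let y : ℕ → E := fun k => ContinuousLinearMap.adjoint T (x k)
  obtain ⟨C, hC⟩ := hx.exists_norm_le
  have hTy : Tendsto (fun k => C * ‖T (y k)‖) atTop (𝓝 0) := by
    simpa only [norm_zero, mul_zero] using (hT y (hx.map _)).norm.const_mul C
  have hsq : Tendsto (fun k => ‖y k‖ ^ 2) atTop (𝓝 0) := by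
    refine squeeze_zero (fun k => sq_nonneg _) (fun k => ?_) hTy
    calc ‖y k‖ ^ 2 = ‖⟪x k, T (y k)⟫_𝕜‖ := by
          rw [← ContinuousLinearMap.adjoint_inner_left, inner_self_eq_norm_sq_to_K, norm_pow,
            RCLike.norm_ofReal, abs_norm]
      _ ≤ C * ‖T (y k)‖ := (norm_inner_le_norm _ _).trans (by gcongr; exact hC k)
  rw [tendsto_zero_iff_norm_tendsto_zero]
  simpa only [Real.sqrt_sq (norm_nonneg _), Real.sqrt_zero] using hsq.sqrt

theorem of_denseRange [CompleteSpace E] {X : Type*} {p : X → E} (hp : DenseRange p)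
    {T : E →L[𝕜] F}
    (h : ∀ φ : ℕ → X, WeaklyNull 𝕜 (fun k => p (φ k)) →
      Tendsto (fun k => T (p (φ k))) atTop (𝓝 0)) :
    CompletelyContinuous T := by
  intro x hx
  choose φ hφ using fun k : ℕ => hp.exists_dist_lt (x k) (Nat.one_div_pos_of_nat (α := ℝ) (n := k))
  have hdiff : Tendsto (fun k => p (φ k) - x k) atTop (𝓝 0) := by
    refine squeeze_zero_norm (fun k => ?_) tendsto_one_div_add_atTop_nhds_zero_nat
    rw [← dist_eq_norm, dist_comm]
    exact (hφ k).le
  have hpφ : WeaklyNull 𝕜 fun k => p (φ k) := by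
    simpa only [Pi.add_def, add_sub_cancel] using hx.add_tendsto_zero hdiff
  have hT := (h φ hpφ).sub ((T.continuous.tendsto 0).comp hdiff)
  simpa only [Function.comp_def, map_sub, sub_sub_cancel, map_zero, sub_zero] using hT

end CompletelyContinuous

section FiniteEigenvalues

open Module End InnerProductSpace

variable {T : E →L[𝕜] E} {z : ℕ → E} {μ : ℕ → 𝕜}

theorem map_sub_smul_mem_span_Iio (hTz : ∀ k, T (z k) = μ k • z k) {k : ℕ} {y : E}
    (hy : y ∈ Submodule.span 𝕜 (z '' Set.Iic k)) :
    T y - μ k • y ∈ Submodule.span 𝕜 (z '' Set.Iio k) := by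
  suffices h : Submodule.span 𝕜 (z '' Set.Iic k) ≤
      (Submodule.span 𝕜 (z '' Set.Iio k)).comap (T.toLinearMap - μ k • LinearMap.id) from h hy
  rw [Submodule.span_le]
  rintro _ ⟨i, hi, rfl⟩
  change T (z i) - μ k • z i ∈ Submodule.span 𝕜 (z '' Set.Iio k)
  rw [hTz, ← sub_smul]
  rcases (show i ≤ k from hi).eq_or_lt with rfl | hlt
  · rw [sub_self, zero_smul]
    exact zero_mem _
  · exact Submodule.smul_mem _ _ (Submodule.subset_span ⟨i, hlt, rfl⟩)

theorem inner_gramSchmidtNormed_map_self (hz : LinearIndependent 𝕜 z)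
    (hTz : ∀ k, T (z k) = μ k • z k) (k : ℕ) :
    ⟪gramSchmidtNormed 𝕜 z k, T (gramSchmidtNormed 𝕜 z k)⟫_𝕜 = μ k := by
  have he := gramSchmidtNormed_orthonormal hz
  set e := gramSchmidtNormed 𝕜 z with he_def
  have hek : e k ∈ Submodule.span 𝕜 (z '' Set.Iic k) := by
    rw [← span_gramSchmidt_Iic, ← span_gramSchmidtNormed]
    exact Submodule.subset_span ⟨k, le_refl k, rfl⟩
  have hdiff : T (e k) - μ k • e k ∈ Submodule.span 𝕜 (e '' Set.Iio k) := by
    rw [he_def, span_gramSchmidtNormed, span_gramSchmidt_Iio]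
    exact map_sub_smul_mem_span_Iio hTz hek
  have horth : Submodule.span 𝕜 (e '' Set.Iio k) ≤ (𝕜 ∙ e k)ᗮ := by
    rw [Submodule.span_le]
    rintro _ ⟨i, hi, rfl⟩
    exact Submodule.mem_orthogonal_singleton_iff_inner_right.2 (he.2 (ne_of_gt hi))
  have hzero := Submodule.mem_orthogonal_singleton_iff_inner_right.1 (horth hdiff)
  rwa [inner_sub_right, inner_smul_right, inner_self_eq_norm_sq_to_K, he.1 k, RCLike.ofReal_one,
    one_pow, mul_one, sub_eq_zero] at hzero

theorem CompletelyContinuous.finite_eigenvalues (hT : CompletelyContinuous T) {r : ℝ}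
    (hr : 0 < r) : {μ : 𝕜 | r ≤ ‖μ‖ ∧ HasEigenvalue (T : End 𝕜 E) μ}.Finite := by
  rw [← Set.not_infinite]
  intro hinf
  let μ : ℕ → 𝕜 := fun k => (hinf.natEmbedding _ k : 𝕜)
  have hμinj : Function.Injective μ :=
    Subtype.val_injective.comp (hinf.natEmbedding _).injective
  have hμ : ∀ k, r ≤ ‖μ k‖ ∧ HasEigenvalue (T : End 𝕜 E) (μ k) :=
    fun k => (hinf.natEmbedding _ k).2
  choose z hz using fun k => (hμ k).2.exists_hasEigenvector
  have hlin : LinearIndependent 𝕜 z := eigenvectors_linearIndependent' _ μ hμinj z hz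
  have he := gramSchmidtNormed_orthonormal hlin
  have hTe := (hT _ (weaklyNull_of_orthonormal he)).norm
  rw [norm_zero] at hTe
  obtain ⟨k, hk⟩ := (hTe.eventually (gt_mem_nhds hr)).exists
  refine hk.not_ge ((hμ k).1.trans ?_)
  calc ‖μ k‖ = ‖⟪gramSchmidtNormed 𝕜 z k, T (gramSchmidtNormed 𝕜 z k)⟫_𝕜‖ := by
        rw [inner_gramSchmidtNormed_map_self hlin fun k => (hz k).apply_eq_smul]
    _ ≤ ‖T (gramSchmidtNormed 𝕜 z k)‖ :=
        (norm_inner_le_norm _ _).trans (by rw [he.1 k, one_mul])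

end FiniteEigenvalues

section Compression

variable [CompleteSpace E]

theorem isUnit_adjoint_subtypeL_comp_comp {M : E →L[𝕜] E} {c : ℝ} (hc : 0 < c)
    (hM : ∀ x, c * ‖x‖ ^ 2 ≤ ‖⟪M x, x⟫_𝕜‖) (K : Submodule 𝕜 E) [CompleteSpace K] :
    IsUnit ((ContinuousLinearMap.adjoint K.subtypeL ∘L M) ∘L K.subtypeL) := by
  refine ContinuousLinearMap.isUnit_of_forall_le_norm_inner_map _ (c := ⟨c, hc.le⟩) hc fun x => ?_
  rw [mul_comm, ContinuousLinearMap.comp_apply, ContinuousLinearMap.comp_apply,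
    ContinuousLinearMap.adjoint_inner_left]
  exact hM x

end Compression

section Pencil

variable [CompleteSpace E] [CompleteSpace F] [CompleteSpace H]

/-- The pencil is linearised by passing to the pair `(f, λ S f)`, an eigenvector for `λ⁻¹`. -/
theorem CompletelyContinuous.finite_quadratic_pencil {K : E →L[𝕜] E} {L : F →L[𝕜] E}
    {S : E →L[𝕜] F} (hK : CompletelyContinuous K) (hL : CompletelyContinuous L)
    (hS : CompletelyContinuous S) (r : ℝ) :
    {lam : 𝕜 | ‖lam‖ ≤ r ∧ ∃ f : E, f ≠ 0 ∧ f = lam • K f + lam ^ 2 • L (S f)}.Finite := by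
  let p₁ : WithLp 2 (E × F) →L[𝕜] E := WithLp.fstL 2 𝕜 E F
  let p₂ : WithLp 2 (E × F) →L[𝕜] F := WithLp.sndL 2 𝕜 E F
  let i := (WithLp.prodContinuousLinearEquiv 2 𝕜 E F).symm.toContinuousLinearMap
  let T : WithLp 2 (E × F) →L[𝕜] WithLp 2 (E × F) :=
    i ∘L ((K ∘L p₁ + L ∘L p₂).prod (S ∘L p₁))
  have hT : CompletelyContinuous T := fun x hx => by
    have hx' := ((hK.comp_right p₁).add (hL.comp_right p₂) x hx).prodMk_nhds
      ((hS.comp_right p₁) x hx)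
    simpa only [map_zero, Prod.mk_zero_zero] using! (i.continuous.tendsto (0, 0)).comp hx'
  refine ((hT.finite_eigenvalues (r := (|r| + 1)⁻¹) (by positivity)).image (·⁻¹)).subset ?_
  rintro lam ⟨hr, f, hf, h⟩
  have hlam : lam ≠ 0 := by
    rintro rfl
    exact hf (by simpa using h)
  refine ⟨lam⁻¹, ⟨?_, ?_⟩, inv_inv lam⟩
  · rw [norm_inv]
    have := norm_pos_iff.2 hlam
    gcongr
    linarith [le_abs_self r]
  · refine Module.End.hasEigenvalue_of_hasEigenvector (x := WithLp.toLp 2 (f, lam • S f)) ?_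
    rw [Module.End.hasEigenvector_iff, Module.End.mem_eigenspace_iff, eq_inv_smul_iff₀ hlam]
    refine ⟨(WithLp.equiv 2 _).injective (Prod.ext ?_ rfl), fun h0 => hf (congrArg (·.fst) h0)⟩
    change lam • (K f + L (lam • S f)) = f
    rw [map_smul, smul_add, smul_smul, ← pow_two]
    exact h.symm

theorem CompletelyContinuous.finite_factored_pencil {B S : E →L[𝕜] H} {J T : H →L[𝕜] E}
    (hBJ : IsUnit (B ∘L J)) (hS : CompletelyContinuous S) (hT : CompletelyContinuous T) (r : ℝ) :
    {lam : 𝕜 | ‖lam‖ ≤ r ∧ ∃ f : H, f ≠ 0 ∧ (B - lam • S) ((J - lam • T) f) = 0}.Finite := by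
  obtain ⟨U, hU⟩ := hBJ
  let R : H →L[𝕜] H := ↑U⁻¹
  have hR : ∀ f, R (B (J f)) = f := fun f => by
    have := congrArg (fun A : H →L[𝕜] H => A f) U.inv_mul
    rwa [hU] at this
  have hK : CompletelyContinuous (R ∘L (B ∘L T + S ∘L J)) :=
    ((hT.comp_left B).add (hS.comp_right J)).comp_left R
  refine (hK.finite_quadratic_pencil (hS.comp_left R).neg hT r).subset ?_
  rintro lam ⟨hlam, f, hf, h⟩
  refine ⟨hlam, f, hf, ?_⟩
  have hBJf : B (J f) = lam • (B (T f) + S (J f)) - lam ^ 2 • S (T f) := by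
    simp only [sub_apply, smul_apply, map_sub, map_smul, smul_sub, smul_smul] at h
    rw [← sub_eq_zero, ← h]
    module
  calc f = R (B (J f)) := (hR f).symm
    _ = lam • R (B (T f) + S (J f)) + lam ^ 2 • -R (S (T f)) := by
      rw [hBJf, map_sub, map_smul, map_smul, smul_neg, sub_eq_add_neg]

end Pencil

end CompletelyContinuous

theorem isClosed_and_isDiscrete_of_finite_closedBall {X : Type*} [MetricSpace X]
    {S : Set X} (x₀ : X) (h : ∀ r : ℝ, (S ∩ Metric.closedBall x₀ r).Finite) :
    IsClosed S ∧ IsDiscrete S := by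
  rw [isClosed_and_discrete_iff]
  intro z
  rw [Filter.disjoint_principal_right]
  have hball : Metric.ball z 1 ∈ 𝓝 z := Metric.ball_mem_nhds z one_pos
  have hfin : ((S ∩ Metric.closedBall x₀ (1 + dist z x₀)) \ {z})ᶜ ∈ 𝓝 z :=
    ((h _).subset Set.sdiff_subset).isClosed.isOpen_compl.mem_nhds (by simp)
  filter_upwards [mem_nhdsWithin_of_mem_nhds hball, mem_nhdsWithin_of_mem_nhds hfin,
    self_mem_nhdsWithin] with y hy hyfin hyz hyS
  refine hyfin ⟨⟨hyS, ?_⟩, hyz⟩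
  exact (dist_triangle y z x₀).trans (add_le_add_left (Metric.mem_ball.1 hy).le _)

/-! ### Differential operators on test functions -/

section Calculus

open scoped SchwartzMap FourierTransform
open MvPolynomial (X C pderiv eval)

variable {n : ℕ} {Ω : Opens (Space n)}

/-- A test function on `Ω`, extended by zero, as a Schwartz function. -/
def toSchwartz : 𝓓(Ω, ℂ) →ₗ[ℂ] 𝓢(Space n, ℂ) where
  toFun φ := φ.hasCompactSupport.toSchwartzMap φ.contDiff
  map_add' _ _ := rfl
  map_smul' _ _ := rfl

theorem toSchwartz_apply (φ : 𝓓(Ω, ℂ)) (x : Space n) : toSchwartz φ x = φ x := rfl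

theorem toSchwartz_injective : Function.Injective (toSchwartz (Ω := Ω)) := fun φ ψ h => by
  ext x
  exact DFunLike.congr_fun h x

theorem ext_fourier {φ ψ : 𝓓(Ω, ℂ)}
    (h : ∀ ξ, 𝓕 (toSchwartz φ) ξ = 𝓕 (toSchwartz ψ) ξ) : φ = ψ :=
  toSchwartz_injective <| (FourierTransform.fourierCLE ℂ 𝓢(Space n, ℂ)).injective <|
    SchwartzMap.ext h

/-- The symbol `P(2πξ)` of `P(D)`; the factor `2π` comes from the kernel `e^{-2πi x·ξ}` of the
Fourier transform. -/
def symbol (P : MvPolynomial (Fin n) ℝ) (ξ : Space n) : ℝ :=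
  eval (fun j => ((2 * Real.pi) • ξ) j) P

theorem fourier_D (j : Fin n) (φ : 𝓓(Ω, ℂ)) (ξ : Space n) :
    𝓕 (toSchwartz (D j φ)) ξ = (2 * Real.pi * ξ j : ℝ) * 𝓕 (toSchwartz φ) ξ := by
  have hD : toSchwartz (D j φ)
      = (-Complex.I) • ∂_{EuclideanSpace.single j (1 : ℝ)} (toSchwartz φ) := rfl
  have hgrowth :
      (inner ℝ · (EuclideanSpace.single j (1 : ℝ)) : Space n → ℝ).HasTemperateGrowth := by
    fun_prop
  rw [hD, FourierTransform.fourier_smul, SchwartzMap.fourier_lineDerivOp_eq, smul_apply,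
    smul_apply, SchwartzMap.smulLeftCLM_apply_apply hgrowth, EuclideanSpace.inner_single_right]
  simp only [smul_eq_mul, Complex.real_smul, conj_trivial]
  push_cast
  linear_combination -(2 * Real.pi * ξ j * 𝓕 (toSchwartz φ) ξ) * Complex.I_sq

theorem fourier_D_iterate (j : Fin n) (k : ℕ) (φ : 𝓓(Ω, ℂ)) (ξ : Space n) :
    𝓕 (toSchwartz ((D j)^[k] φ)) ξ = ((2 * Real.pi * ξ j) ^ k : ℝ) * 𝓕 (toSchwartz φ) ξ := by
  induction k with
  | zero => simp
  | succ k ih =>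
    rw [Function.iterate_succ_apply', fourier_D, ih]
    push_cast
    ring

theorem fourier_multiD (α : Fin n →₀ ℕ) (φ : 𝓓(Ω, ℂ)) (ξ : Space n) :
    𝓕 (toSchwartz (multiD α φ)) ξ
      = (∏ j, (2 * Real.pi * ξ j) ^ α j : ℝ) * 𝓕 (toSchwartz φ) ξ := by
  suffices h : ∀ l : List (Fin n), 𝓕 (toSchwartz (l.foldr (fun j ψ => (D j)^[α j] ψ) φ)) ξ
      = ((l.map fun j => (2 * Real.pi * ξ j) ^ α j).prod : ℝ) * 𝓕 (toSchwartz φ) ξ by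
    rw [multiD, h, ← List.ofFn_eq_map, List.prod_ofFn]
  intro l
  induction l with
  | nil => simp
  | cons j l ih =>
    rw [List.foldr_cons, fourier_D_iterate, ih, List.map_cons, List.prod_cons]
    push_cast
    ring

theorem fourier_sum_smul_multiD (s : Finset (Fin n →₀ ℕ)) (c : (Fin n →₀ ℕ) → ℂ) (φ : 𝓓(Ω, ℂ))
    (ξ : Space n) :
    𝓕 (toSchwartz (∑ α ∈ s, c α • multiD α φ)) ξ
      = (∑ α ∈ s, c α * (∏ j, (2 * Real.pi * ξ j) ^ α j : ℝ)) * 𝓕 (toSchwartz φ) ξ := by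
  rw [map_sum, ← FourierTransform.fourierCLM_apply (R := ℂ), map_sum, sum_apply, Finset.sum_mul]
  refine Finset.sum_congr rfl fun α _ => ?_
  rw [map_smul, map_smul, smul_apply, FourierTransform.fourierCLM_apply, fourier_multiD,
    smul_eq_mul, mul_assoc]

theorem fourier_diffOp (P : MvPolynomial (Fin n) ℝ) (φ : 𝓓(Ω, ℂ)) (ξ : Space n) :
    𝓕 (toSchwartz (diffOp P φ)) ξ = symbol P ξ * 𝓕 (toSchwartz φ) ξ := by
  rw [diffOp, fourier_sum_smul_multiD, symbol, MvPolynomial.eval_eq', Complex.ofReal_sum]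
  simp only [Complex.ofReal_mul, PiLp.smul_apply, smul_eq_mul]

theorem fourier_diffOpTranspose (P : MvPolynomial (Fin n) ℝ) (φ : 𝓓(Ω, ℂ)) (ξ : Space n) :
    𝓕 (toSchwartz (diffOpTranspose P φ)) ξ = symbol P (-ξ) * 𝓕 (toSchwartz φ) ξ := by
  rw [diffOpTranspose, fourier_sum_smul_multiD, symbol, MvPolynomial.eval_eq', Complex.ofReal_sum]
  congr 1
  refine Finset.sum_congr rfl fun α _ => ?_
  have hneg : ∏ j, ((2 * Real.pi) • -ξ) j ^ α j
      = (-1) ^ α.degree * ∏ j, (2 * Real.pi * ξ j) ^ α j := by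
    rw [Finsupp.degree_eq_sum, ← Finset.prod_pow_eq_pow_sum, ← Finset.prod_mul_distrib]
    refine Finset.prod_congr rfl fun j _ => ?_
    rw [← mul_pow, PiLp.smul_apply, PiLp.neg_apply, smul_eq_mul]
    ring
  rw [hneg]
  push_cast
  ring

theorem fourier_toSchwartz_add (φ ψ : 𝓓(Ω, ℂ)) (ξ : Space n) :
    𝓕 (toSchwartz (φ + ψ)) ξ = 𝓕 (toSchwartz φ) ξ + 𝓕 (toSchwartz ψ) ξ := by
  rw [map_add, FourierTransform.fourier_add, add_apply]

theorem fourier_toSchwartz_smul (c : ℂ) (φ : 𝓓(Ω, ℂ)) (ξ : Space n) :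
    𝓕 (toSchwartz (c • φ)) ξ = c * 𝓕 (toSchwartz φ) ξ := by
  rw [map_smul, FourierTransform.fourier_smul, smul_apply, smul_eq_mul]

/-- `P(D)` as a linear map on test functions. -/
def diffOpLin (P : MvPolynomial (Fin n) ℝ) : 𝓓(Ω, ℂ) →ₗ[ℂ] 𝓓(Ω, ℂ) where
  toFun := diffOp P
  map_add' φ ψ := ext_fourier fun ξ => by
    simp only [fourier_diffOp, fourier_toSchwartz_add, mul_add]
  map_smul' c φ := ext_fourier fun ξ => by
    simp only [fourier_diffOp, fourier_toSchwartz_smul, RingHom.id_apply, mul_left_comm]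

theorem diffOp_sub (P : MvPolynomial (Fin n) ℝ) (φ ψ : 𝓓(Ω, ℂ)) :
    diffOp P (φ - ψ) = diffOp P φ - diffOp P ψ := map_sub (diffOpLin P) φ ψ

theorem diffOp_smul (P : MvPolynomial (Fin n) ℝ) (c : ℂ) (φ : 𝓓(Ω, ℂ)) :
    diffOp P (c • φ) = c • diffOp P φ := map_smul (diffOpLin P) c φ

theorem diffOp_C (a : ℝ) (φ : 𝓓(Ω, ℂ)) : diffOp (C a) φ = (a : ℂ) • φ :=
  ext_fourier fun ξ => by
    rw [fourier_diffOp, symbol, MvPolynomial.eval_C, fourier_toSchwartz_smul]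

theorem diffOp_zero (φ : 𝓓(Ω, ℂ)) : diffOp 0 φ = 0 := by
  rw [← map_zero C, diffOp_C, Complex.ofReal_zero, zero_smul]

theorem diffOp_one (φ : 𝓓(Ω, ℂ)) : diffOp 1 φ = φ := by
  rw [← map_one C, diffOp_C, Complex.ofReal_one, one_smul]

theorem diffOp_X (j : Fin n) (φ : 𝓓(Ω, ℂ)) : diffOp (X j) φ = D j φ :=
  ext_fourier fun ξ => by
    rw [fourier_diffOp, symbol, MvPolynomial.eval_X, fourier_D, PiLp.smul_apply, smul_eq_mul]

theorem diffOp_add (P Q : MvPolynomial (Fin n) ℝ) (φ : 𝓓(Ω, ℂ)) :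
    diffOp (P + Q) φ = diffOp P φ + diffOp Q φ :=
  ext_fourier fun ξ => by
    rw [fourier_toSchwartz_add]
    simp only [fourier_diffOp, symbol, map_add, Complex.ofReal_add, add_mul]

theorem diffOp_mul (P Q : MvPolynomial (Fin n) ℝ) (φ : 𝓓(Ω, ℂ)) :
    diffOp (P * Q) φ = diffOp P (diffOp Q φ) :=
  ext_fourier fun ξ => by
    simp only [fourier_diffOp, symbol, map_mul, Complex.ofReal_mul, mul_assoc]

theorem D_apply (j : Fin n) (φ : 𝓓(Ω, ℂ)) (x : Space n) :
    D j φ x = -Complex.I * fderiv ℝ φ x (EuclideanSpace.single j 1) := by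
  rw [← toSchwartz_apply]
  rfl

/-- Multiplication of test functions by the coordinate `x_j`. -/
def mulCoord (j : Fin n) : 𝓓(Ω, ℂ) →ₗ[ℂ] 𝓓(Ω, ℂ) where
  toFun φ :=
    { toFun := fun x => (x j : ℂ) * φ x
      contDiff' := (Complex.ofRealCLM.contDiff.comp
        (EuclideanSpace.proj (𝕜 := ℝ) j).contDiff).mul φ.contDiff
      hasCompactSupport' := φ.hasCompactSupport.mul_left
      tsupport_subset' := (tsupport_mul_subset_right).trans φ.tsupport_subset }
  map_add' φ ψ := by
    ext x
    exact mul_add _ _ _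
  map_smul' c φ := by
    ext x
    exact mul_left_comm _ _ _

theorem mulCoord_apply (j : Fin n) (φ : 𝓓(Ω, ℂ)) (x : Space n) :
    mulCoord j φ x = (x j : ℂ) * φ x := rfl

theorem D_mulCoord (i j : Fin n) (φ : 𝓓(Ω, ℂ)) :
    D i (mulCoord j φ) = mulCoord j (D i φ) - Complex.I • diffOp (pderiv j (X i)) φ := by
  ext x
  have hcoord : HasFDerivAt (fun y : Space n => (y j : ℂ))
      (Complex.ofRealCLM ∘L EuclideanSpace.proj j) x :=
    (Complex.ofRealCLM ∘L EuclideanSpace.proj (𝕜 := ℝ) j).hasFDerivAt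
  have hφ : HasFDerivAt φ (fderiv ℝ φ x) x := (φ.contDiff.differentiable (by simp) x).hasFDerivAt
  have hmul : HasFDerivAt (mulCoord j φ) _ x := hcoord.mul hφ
  rw [sub_apply, smul_apply, mulCoord_apply, D_apply, D_apply, hmul.fderiv]
  rcases eq_or_ne i j with rfl | hij
  · simp only [add_apply, smul_apply, smul_eq_mul, ContinuousLinearMap.comp_apply,
      PiLp.proj_apply, PiLp.single_eq_same, Complex.ofRealCLM_apply, Complex.ofReal_one,
      MvPolynomial.pderiv_X_self, diffOp_one]
    ring
  · simp only [add_apply, smul_apply, smul_eq_mul, ContinuousLinearMap.comp_apply,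
      PiLp.proj_apply, PiLp.single_eq_of_ne _ hij.symm, Complex.ofRealCLM_apply,
      Complex.ofReal_zero, MvPolynomial.pderiv_X_of_ne hij, diffOp_zero, zero_apply]
    ring

theorem diffOp_mulCoord (P : MvPolynomial (Fin n) ℝ) (j : Fin n) (φ : 𝓓(Ω, ℂ)) :
    diffOp P (mulCoord j φ) = mulCoord j (diffOp P φ) - Complex.I • diffOp (pderiv j P) φ := by
  induction P using MvPolynomial.induction_on generalizing φ with
  | C a =>
    rw [MvPolynomial.pderiv_C, diffOp_C, diffOp_C, map_smul, diffOp_zero, smul_zero, sub_zero]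
  | add P Q hP hQ =>
    rw [diffOp_add, diffOp_add, hP, hQ, map_add, map_add, diffOp_add, smul_add]
    abel
  | mul_X P i hP =>
    rw [diffOp_mul, diffOp_mul, diffOp_X, diffOp_X, D_mulCoord, diffOp_sub, diffOp_smul, hP,
      Derivation.leibniz, diffOp_add, smul_eq_mul, smul_eq_mul, mul_comm (X i), diffOp_mul,
      diffOp_mul, diffOp_X, smul_add]
    abel

end Calculus

/-! ### Hörmander's inequality -/

section L2

open scoped FourierTransform InnerProductSpace
open MvPolynomial (C pderiv)

variable {n : ℕ} {Ω : Opens (Space n)}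

/-- The Hilbert space `L²(Ω)`. -/
abbrev L2 (Ω : Opens (Space n)) : Type := Lp ℂ 2 (volume.restrict (Ω : Set (Space n)))

theorem memLp_testFunction (φ : 𝓓(Ω, ℂ)) :
    MemLp φ 2 (volume.restrict (Ω : Set (Space n))) :=
  (φ.continuous.memLp_of_hasCompactSupport φ.hasCompactSupport).restrict _

/-- The inclusion of the test functions into `L²(Ω)`. -/
def toL2 : 𝓓(Ω, ℂ) →ₗ[ℂ] L2 Ω where
  toFun φ := (memLp_testFunction φ).toLp φ
  map_add' _ _ := rfl
  map_smul' _ _ := rfl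

theorem coeFn_toL2 (φ : 𝓓(Ω, ℂ)) : toL2 φ =ᵐ[volume.restrict (Ω : Set (Space n))] φ :=
  (memLp_testFunction φ).coeFn_toLp

theorem support_testFunction_subset (φ : 𝓓(Ω, ℂ)) : Function.support φ ⊆ Ω :=
  (subset_tsupport φ).trans φ.tsupport_subset

theorem inner_toL2 (φ ψ : 𝓓(Ω, ℂ)) :
    ⟪toL2 φ, toL2 ψ⟫_ℂ = ∫ ξ, ⟪𝓕 (toSchwartz φ) ξ, 𝓕 (toSchwartz ψ) ξ⟫_ℂ := by
  calc ⟪toL2 φ, toL2 ψ⟫_ℂ = ∫ x in (Ω : Set (Space n)), ⟪φ x, ψ x⟫_ℂ := by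
        rw [L2.inner_def]
        refine integral_congr_ae ?_
        filter_upwards [coeFn_toL2 φ, coeFn_toL2 ψ] with x hφ hψ
        rw [hφ, hψ]
    _ = ∫ x, ⟪φ x, ψ x⟫_ℂ := setIntegral_eq_integral_of_forall_compl_eq_zero fun x hx => by
        rw [Function.notMem_support.1 fun h => hx (support_testFunction_subset ψ h),
          inner_zero_right]
    _ = ∫ ξ, ⟪𝓕 (toSchwartz φ) ξ, 𝓕 (toSchwartz ψ) ξ⟫_ℂ :=
        (SchwartzMap.integral_inner_fourier_fourier (toSchwartz φ) (toSchwartz ψ)).symm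

theorem norm_toL2_sq (φ : 𝓓(Ω, ℂ)) : ‖toL2 φ‖ ^ 2 = ∫ ξ, ‖𝓕 (toSchwartz φ) ξ‖ ^ 2 := by
  apply Complex.ofRealLI.injective
  simpa [← LinearIsometry.integral_comp_comm, inner_self_eq_norm_sq_to_K] using inner_toL2 φ φ

theorem inner_diffOp (P : MvPolynomial (Fin n) ℝ) (φ ψ : 𝓓(Ω, ℂ)) :
    ⟪toL2 (diffOp P φ), toL2 ψ⟫_ℂ = ⟪toL2 φ, toL2 (diffOp P ψ)⟫_ℂ := by
  simp only [inner_toL2, fourier_diffOp, RCLike.inner_apply, map_mul, Complex.conj_ofReal]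
  congr 1 with ξ
  ring

theorem norm_toL2_mulCoord_le {A : ℝ} (hA : ∀ x ∈ Ω, ‖x‖ ≤ A) (j : Fin n) (φ : 𝓓(Ω, ℂ)) :
    ‖toL2 (mulCoord j φ)‖ ≤ A * ‖toL2 φ‖ := by
  refine Lp.norm_le_mul_norm_of_ae_le_mul ?_
  filter_upwards [coeFn_toL2 φ, coeFn_toL2 (mulCoord j φ),
    ae_restrict_mem Ω.isOpen.measurableSet] with x hφ hxφ hx
  rw [hφ, hxφ, mulCoord_apply, norm_mul, Complex.norm_real]
  gcongr
  exact (PiLp.norm_apply_le x j).trans (hA x hx)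

/-- The operator `Q(D)` is weaker than `P(D)` on `Ω`: `‖Q(D)φ‖ ≤ K ‖P(D)φ‖` in `L²(Ω)` for all
test functions `φ`. -/
def IsWeaker (Ω : Opens (Space n)) (Q P : MvPolynomial (Fin n) ℝ) : Prop :=
  (fun φ : 𝓓(Ω, ℂ) => toL2 (diffOp Q φ)) =O[⊤] fun φ => toL2 (diffOp P φ)

/-- Hörmander's inequality: `(∂_j P)(D)φ` is paired with the commutator identity
`P(D)(x_j φ) = x_j P(D)φ - i (∂_j P)(D)φ`. -/
theorem norm_diffOp_pderiv_sq_le {A : ℝ} (hA : ∀ x ∈ Ω, ‖x‖ ≤ A) (P : MvPolynomial (Fin n) ℝ)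
    (j : Fin n) (φ : 𝓓(Ω, ℂ)) :
    ‖toL2 (diffOp (pderiv j P) φ)‖ ^ 2 ≤ ‖toL2 (diffOp P φ)‖ *
      (2 * A * ‖toL2 (diffOp (pderiv j P) φ)‖ + ‖toL2 (diffOp (pderiv j (pderiv j P)) φ)‖) := by
  set Q := pderiv j P
  let x := mulCoord (Ω := Ω) j
  have hcomm : Complex.I • toL2 (diffOp Q φ)
      = toL2 (x (diffOp P φ)) - toL2 (diffOp P (x φ)) := by
    rw [diffOp_mulCoord, map_sub, map_smul, sub_sub_cancel]
  have hsymm : ⟪toL2 (diffOp Q φ), toL2 (diffOp P (x φ))⟫_ℂ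
      = ⟪toL2 (diffOp P φ), toL2 (diffOp Q (x φ))⟫_ℂ := by
    rw [← inner_diffOp, ← inner_diffOp, ← diffOp_mul, ← diffOp_mul, mul_comm]
  have hQx : ‖toL2 (diffOp Q (x φ))‖
      ≤ A * ‖toL2 (diffOp Q φ)‖ + ‖toL2 (diffOp (pderiv j Q) φ)‖ := by
    rw [diffOp_mulCoord, map_sub, map_smul]
    refine (norm_sub_le _ _).trans ?_
    rw [norm_smul, Complex.norm_I, one_mul]
    gcongr
    exact norm_toL2_mulCoord_le hA j _
  calc ‖toL2 (diffOp Q φ)‖ ^ 2 = ‖⟪toL2 (diffOp Q φ), Complex.I • toL2 (diffOp Q φ)⟫_ℂ‖ := by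
        rw [inner_smul_right, norm_mul, Complex.norm_I, one_mul, inner_self_eq_norm_sq_to_K,
          norm_pow, RCLike.norm_ofReal, abs_norm]
    _ = ‖⟪toL2 (diffOp Q φ), toL2 (x (diffOp P φ))⟫_ℂ
          - ⟪toL2 (diffOp P φ), toL2 (diffOp Q (x φ))⟫_ℂ‖ := by
        rw [hcomm, inner_sub_right, hsymm]
    _ ≤ ‖toL2 (diffOp Q φ)‖ * (A * ‖toL2 (diffOp P φ)‖) + ‖toL2 (diffOp P φ)‖ *
          (A * ‖toL2 (diffOp Q φ)‖ + ‖toL2 (diffOp (pderiv j Q) φ)‖) := by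
        refine (norm_sub_le _ _).trans (add_le_add ?_ ?_)
        · exact (norm_inner_le_norm _ _).trans (by gcongr; exact norm_toL2_mulCoord_le hA j _)
        · exact (norm_inner_le_norm _ _).trans (by gcongr)
    _ = _ := by ring

theorem totalDegree_pderiv_lt {σ R : Type*} [CommSemiring R] {P : MvPolynomial σ R}
    (hP : 0 < P.totalDegree) (j : σ) : (pderiv j P).totalDegree < P.totalDegree := by
  classical
  rw [MvPolynomial.totalDegree, Finset.sup_lt_iff hP]
  intro m hm
  rw [MvPolynomial.mem_support_iff, MvPolynomial.coeff_pderiv] at hm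
  have hsupp : m + Finsupp.single j 1 ∈ P.support := by
    rw [MvPolynomial.mem_support_iff]
    exact left_ne_zero_of_mul hm
  have hle := MvPolynomial.le_totalDegree hsupp
  rw [Finsupp.sum_add_index' (by simp) (by simp), Finsupp.sum_single_index rfl] at hle
  exact hle

theorem exists_pderiv_ne_zero {σ R : Type*} [CommSemiring R] [NoZeroDivisors R] [CharZero R]
    {P : MvPolynomial σ R} (hP : 0 < P.totalDegree) : ∃ j, pderiv j P ≠ 0 := by
  classical
  have hne : P.totalDegree ≠ 0 := hP.ne'
  rw [ne_eq, MvPolynomial.totalDegree_eq_zero_iff] at hne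
  push Not at hne
  obtain ⟨m, hm, j, hj⟩ := hne
  refine ⟨j, fun h0 => ?_⟩
  have hcoeff := congrArg (MvPolynomial.coeff (m - Finsupp.single j 1)) h0
  have hle : Finsupp.single j 1 ≤ m := Finsupp.single_le_iff.2 (Nat.one_le_iff_ne_zero.2 hj)
  rw [MvPolynomial.coeff_pderiv, tsub_add_cancel_of_le hle, MvPolynomial.coeff_zero] at hcoeff
  exact mul_ne_zero (MvPolynomial.mem_support_iff.1 hm) (Nat.cast_add_one_ne_zero _) hcoeff

theorem isWeaker_pderiv (hΩ : Bornology.IsBounded (Ω : Set (Space n)))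
    (P : MvPolynomial (Fin n) ℝ) (j : Fin n) : IsWeaker Ω (pderiv j P) P := by
  obtain ⟨A, hA⟩ := hΩ.exists_norm_le
  induction hm : P.totalDegree using Nat.strong_induction_on generalizing P with
  | _ m ih =>
    rcases P.totalDegree.eq_zero_or_pos with hP | hP
    · rw [MvPolynomial.totalDegree_eq_zero_iff_eq_C.1 hP, MvPolynomial.pderiv_C]
      simp only [IsWeaker, diffOp_zero, map_zero]
      exact Asymptotics.isBigO_zero _ _
    obtain ⟨K, hK⟩ := Asymptotics.isBigO_top.1 (ih _ (hm ▸ totalDegree_pderiv_lt hP j) _ rfl)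
    refine Asymptotics.isBigO_top.2 ⟨|2 * A + K|, fun φ => ?_⟩
    rcases (norm_nonneg (toL2 (diffOp (pderiv j P) φ))).eq_or_lt' with hQ | hQ
    · rw [hQ]
      positivity
    refine le_of_mul_le_mul_right ?_ hQ
    calc ‖toL2 (diffOp (pderiv j P) φ)‖ * ‖toL2 (diffOp (pderiv j P) φ)‖
        ≤ ‖toL2 (diffOp P φ)‖ * (2 * A * ‖toL2 (diffOp (pderiv j P) φ)‖
          + K * ‖toL2 (diffOp (pderiv j P) φ)‖) := by
          rw [← sq]
          refine (norm_diffOp_pderiv_sq_le hA P j φ).trans ?_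
          gcongr
          exact hK φ
      _ = (2 * A + K) * ‖toL2 (diffOp P φ)‖ * ‖toL2 (diffOp (pderiv j P) φ)‖ := by ring
      _ ≤ |2 * A + K| * ‖toL2 (diffOp P φ)‖ * ‖toL2 (diffOp (pderiv j P) φ)‖ := by
          gcongr
          exact le_abs_self _

theorem isWeaker_multiPderiv (hΩ : Bornology.IsBounded (Ω : Set (Space n)))
    (P : MvPolynomial (Fin n) ℝ) (α : Fin n → ℕ) : IsWeaker Ω (multiPderiv α P) P := by
  have hiter : ∀ (j : Fin n) (k : ℕ) (Q : MvPolynomial (Fin n) ℝ),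
      IsWeaker Ω ((pderiv j)^[k] Q) Q := fun j k Q => by
    induction k with
    | zero => exact Asymptotics.isBigO_refl _ _
    | succ k ih =>
      rw [Function.iterate_succ_apply']
      exact (isWeaker_pderiv hΩ _ j).trans ih
  rw [multiPderiv]
  induction List.finRange n with
  | nil => exact Asymptotics.isBigO_refl _ _
  | cons j l ih => exact (hiter j _ _).trans ih

theorem isWeaker_one (hΩ : Bornology.IsBounded (Ω : Set (Space n)))
    {P : MvPolynomial (Fin n) ℝ} (hP : P ≠ 0) : IsWeaker Ω 1 P := by
  induction hm : P.totalDegree using Nat.strong_induction_on generalizing P with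
  | _ m ih =>
    rcases P.totalDegree.eq_zero_or_pos with hdeg | hdeg
    · obtain ⟨a, rfl⟩ : ∃ a, P = C a := ⟨_, MvPolynomial.totalDegree_eq_zero_iff_eq_C.1 hdeg⟩
      have ha : (a : ℂ) ≠ 0 := Complex.ofReal_ne_zero.2 fun h => hP (by rw [h, map_zero])
      refine Asymptotics.isBigO_top.2 ⟨‖(a : ℂ)‖⁻¹, fun φ => ?_⟩
      rw [diffOp_one, diffOp_C, map_smul, norm_smul, inv_mul_cancel_left₀ (norm_ne_zero_iff.2 ha)]
    · obtain ⟨j, hj⟩ := exists_pderiv_ne_zero hdeg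
      exact (ih _ (hm ▸ totalDegree_pderiv_lt hdeg j) hj rfl).trans (isWeaker_pderiv hΩ P j)

end L2

/-! ### Compactness of the minimal operator -/

section Embedding

open scoped FourierTransform InnerProductSpace

variable {n : ℕ} {Ω : Opens (Space n)}

theorem integrable_norm_fourier_sq (φ : 𝓓(Ω, ℂ)) :
    Integrable fun ξ => ‖𝓕 (toSchwartz φ) ξ‖ ^ 2 :=
  ((𝓕 (toSchwartz φ)).memLp 2 volume).integrable_norm_pow two_ne_zero

theorem symbolTilde_sq_mul_norm_fourier_sq (P : MvPolynomial (Fin n) ℝ) (φ : 𝓓(Ω, ℂ))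
    (ξ : Space n) :
    symbolTilde P ((2 * Real.pi) • ξ) ^ 2 * ‖𝓕 (toSchwartz φ) ξ‖ ^ 2
      = ∑ α : Fin n → Fin (P.totalDegree + 1),
        ‖𝓕 (toSchwartz (diffOp (multiPderiv (fun j => (α j : ℕ)) P) φ)) ξ‖ ^ 2 := by
  rw [symbolTilde, Real.sq_sqrt (Finset.sum_nonneg fun _ _ => sq_nonneg _), Finset.sum_mul]
  refine Finset.sum_congr rfl fun α _ => ?_
  rw [fourier_diffOp, norm_mul, mul_pow, Complex.norm_real, Real.norm_eq_abs, sq_abs, symbol]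

theorem integrable_symbolTilde_sq_mul_norm_fourier_sq (P : MvPolynomial (Fin n) ℝ) (φ : 𝓓(Ω, ℂ)) :
    Integrable fun ξ => symbolTilde P ((2 * Real.pi) • ξ) ^ 2 * ‖𝓕 (toSchwartz φ) ξ‖ ^ 2 := by
  simp only [symbolTilde_sq_mul_norm_fourier_sq]
  exact integrable_finsetSum _ fun α _ => integrable_norm_fourier_sq _

theorem exists_integral_symbolTilde_sq_le (hΩ : Bornology.IsBounded (Ω : Set (Space n)))
    (P : MvPolynomial (Fin n) ℝ) :
    ∃ K, ∀ φ : 𝓓(Ω, ℂ), ∫ ξ, symbolTilde P ((2 * Real.pi) • ξ) ^ 2 * ‖𝓕 (toSchwartz φ) ξ‖ ^ 2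
      ≤ K * ‖toL2 (diffOp P φ)‖ ^ 2 := by
  choose K hK using fun α : Fin n → Fin (P.totalDegree + 1) =>
    Asymptotics.isBigO_top.1 (isWeaker_multiPderiv hΩ P (fun j => (α j : ℕ)))
  refine ⟨∑ α, K α ^ 2, fun φ => ?_⟩
  simp only [symbolTilde_sq_mul_norm_fourier_sq]
  rw [integral_finsetSum _ fun α _ => integrable_norm_fourier_sq _, Finset.sum_mul]
  refine Finset.sum_le_sum fun α _ => ?_
  rw [← norm_toL2_sq, ← mul_pow]
  exact pow_le_pow_left₀ (norm_nonneg _) (hK α φ) 2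

/-- The character `x ↦ e^{2πi x·ξ}` as an element of `L²(Ω)`. -/
def character (Ω : Opens (Space n)) [IsFiniteMeasure (volume.restrict (Ω : Set (Space n)))]
    (ξ : Space n) : L2 Ω :=
  (MemLp.of_bound (f := fun x : Space n => (𝐞 (inner ℝ x ξ) : ℂ)) (by fun_prop) 1
    (ae_of_all _ fun _ => (Circle.norm_coe _).le)).toLp

section FiniteMeasure

variable [IsFiniteMeasure (volume.restrict (Ω : Set (Space n)))]

theorem coeFn_character (ξ : Space n) :
    character Ω ξ =ᵐ[volume.restrict (Ω : Set (Space n))] fun x => (𝐞 (inner ℝ x ξ) : ℂ) :=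
  MemLp.coeFn_toLp _

theorem exists_norm_character_le : ∃ K, ∀ ξ, ‖character Ω ξ‖ ≤ K := by
  refine ⟨_, fun ξ => Lp.norm_le_of_ae_bound zero_le_one ?_⟩
  filter_upwards [coeFn_character ξ] with x hx
  rw [hx, Circle.norm_coe]

theorem inner_character_toL2 (ξ : Space n) (φ : 𝓓(Ω, ℂ)) :
    ⟪character Ω ξ, toL2 φ⟫_ℂ = 𝓕 (toSchwartz φ) ξ := by
  calc ⟪character Ω ξ, toL2 φ⟫_ℂ = ∫ x in (Ω : Set (Space n)), 𝐞 (-inner ℝ x ξ) • φ x := by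
        rw [L2.inner_def]
        refine integral_congr_ae ?_
        filter_upwards [coeFn_character ξ, coeFn_toL2 φ] with x hχ hφ
        rw [hχ, hφ, RCLike.inner_apply, ← Circle.coe_inv_eq_conj, ← AddChar.map_neg_eq_inv,
          Circle.smul_def, smul_eq_mul, mul_comm]
    _ = ∫ x, 𝐞 (-inner ℝ x ξ) • φ x :=
      setIntegral_eq_integral_of_forall_compl_eq_zero fun x hx => by
        rw [Function.notMem_support.1 fun h => hx (support_testFunction_subset φ h), smul_zero]
    _ = 𝓕 (toSchwartz φ) ξ := rfl

theorem tendsto_setIntegral_norm_fourier_sq {φ : ℕ → 𝓓(Ω, ℂ)}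
    (hφ : WeaklyNull ℂ fun k => toL2 (φ k)) (R : ℝ) :
    Tendsto (fun k => ∫ ξ in Metric.closedBall 0 R, ‖𝓕 (toSchwartz (φ k)) ξ‖ ^ 2) atTop (𝓝 0) := by
  obtain ⟨K, hK⟩ := exists_norm_character_le (Ω := Ω)
  obtain ⟨M, hM⟩ := hφ.exists_norm_le
  have : IsFiniteMeasure (volume.restrict (Metric.closedBall (0 : Space n) R)) :=
    ⟨by simpa using measure_closedBall_lt_top⟩
  have hbound : ∀ k ξ, ‖𝓕 (toSchwartz (φ k)) ξ‖ ≤ K * M := fun k ξ => by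
    rw [← inner_character_toL2]
    refine (norm_inner_le_norm _ _).trans ?_
    gcongr
    exacts [(norm_nonneg _).trans (hK 0), hK ξ, hM k]
  have hlim : ∀ ξ, Tendsto (fun k => ‖𝓕 (toSchwartz (φ k)) ξ‖ ^ 2) atTop (𝓝 0) := fun ξ => by
    simpa only [inner_character_toL2, norm_zero, zero_pow two_ne_zero] using
      (hφ (character Ω ξ)).norm.pow 2
  rw [← integral_zero (Space n) ℝ (μ := volume.restrict (Metric.closedBall 0 R))]
  refine tendsto_integral_of_dominated_convergence (fun _ => (K * M) ^ 2)
    (fun k => (integrable_norm_fourier_sq (φ k)).aestronglyMeasurable.restrict)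
    (integrable_const _) (fun k => ae_of_all _ fun ξ => ?_) (ae_of_all _ hlim)
  rw [norm_pow, norm_norm]
  exact pow_le_pow_left₀ (norm_nonneg _) (hbound k ξ) 2

end FiniteMeasure

theorem tendsto_integral_zero_of_weight {X : Type*} [PseudoMetricSpace X] [MeasurableSpace X]
    [OpensMeasurableSpace X] {μ : Measure X} (x₀ : X) {h : ℕ → X → ℝ} {W : X → ℝ} {C : ℝ}
    (hW : Tendsto W (Bornology.cobounded X) atTop) (hW₀ : ∀ x, 0 ≤ W x) (hh₀ : ∀ k x, 0 ≤ h k x)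
    (hh : ∀ k, Integrable (h k) μ) (hWh : ∀ k, Integrable (fun x => W x * h k x) μ)
    (hC : ∀ k, ∫ x, W x * h k x ∂μ ≤ C)
    (hball : ∀ R, Tendsto (fun k => ∫ x in Metric.closedBall x₀ R, h k x ∂μ) atTop (𝓝 0)) :
    Tendsto (fun k => ∫ x, h k x ∂μ) atTop (𝓝 0) := by
  have hC₀ : 0 ≤ C := (integral_nonneg fun x => mul_nonneg (hW₀ x) (hh₀ 0 x)).trans (hC 0)
  refine tendsto_order.2 ⟨fun a ha => Eventually.of_forall fun k =>
    ha.trans_le (integral_nonneg (hh₀ k)), fun ε hε => ?_⟩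
  let M := 2 * (C + 1) / ε
  have hM : 0 < M := by positivity
  have hCM : M⁻¹ * C < ε / 2 := by
    rw [inv_mul_lt_iff₀ hM]
    calc C < C + 1 := lt_add_one C
      _ = M * (ε / 2) := by simp only [M]; field_simp
  obtain ⟨R, -, hR⟩ := (Metric.hasBasis_cobounded_compl_closedBall x₀).eventually_iff.1
    (hW.eventually_ge_atTop M)
  filter_upwards [(hball R).eventually_lt_const (half_pos hε)] with k hk
  have hpointwise : ∀ x, h k x
      ≤ (Metric.closedBall x₀ R).indicator (h k) x + M⁻¹ * (W x * h k x) := fun x => by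
    by_cases hx : x ∈ Metric.closedBall x₀ R
    · rw [Set.indicator_of_mem hx, le_add_iff_nonneg_right]
      exact mul_nonneg (inv_nonneg.2 hM.le) (mul_nonneg (hW₀ x) (hh₀ k x))
    · rw [Set.indicator_of_notMem hx, zero_add, le_inv_mul_iff₀ hM]
      exact mul_le_mul_of_nonneg_right (hR hx) (hh₀ k x)
  have hind : Integrable ((Metric.closedBall x₀ R).indicator (h k)) μ :=
    (hh k).indicator Metric.isClosed_closedBall.measurableSet
  calc ∫ x, h k x ∂μ
      ≤ ∫ x, (Metric.closedBall x₀ R).indicator (h k) x + M⁻¹ * (W x * h k x) ∂μ :=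
        integral_mono (hh k) (hind.add ((hWh k).const_mul _)) hpointwise
    _ = ∫ x in Metric.closedBall x₀ R, h k x ∂μ + M⁻¹ * ∫ x, W x * h k x ∂μ := by
        rw [integral_add hind ((hWh k).const_mul _), integral_const_mul,
          integral_indicator Metric.isClosed_closedBall.measurableSet]
    _ ≤ ∫ x in Metric.closedBall x₀ R, h k x ∂μ + M⁻¹ * C := by gcongr; exact hC k
    _ < ε := by linarith

theorem tendsto_toL2_zero (hΩ : Bornology.IsBounded (Ω : Set (Space n)))
    {P : MvPolynomial (Fin n) ℝ}
    (hP : Tendsto (symbolTilde P) (Bornology.cobounded (Space n)) atTop)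
    {φ : ℕ → 𝓓(Ω, ℂ)} {M : ℝ} (hM : ∀ k, ‖toL2 (diffOp P (φ k))‖ ≤ M)
    (hφ : WeaklyNull ℂ fun k => toL2 (φ k)) :
    Tendsto (fun k => toL2 (φ k)) atTop (𝓝 0) := by
  have : IsFiniteMeasure (volume.restrict (Ω : Set (Space n))) := ⟨by simpa using hΩ.measure_lt_top⟩
  obtain ⟨K, hK⟩ := exists_integral_symbolTilde_sq_le hΩ P
  have hscale : Tendsto (fun ξ : Space n => (2 * Real.pi) • ξ) (Bornology.cobounded (Space n))
      (Bornology.cobounded (Space n)) := by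
    rw [← tendsto_norm_atTop_iff_cobounded]
    simpa only [norm_smul] using tendsto_norm_cobounded_atTop.const_mul_atTop
      (norm_pos_iff.2 Real.two_pi_pos.ne')
  have hW : Tendsto (fun ξ => symbolTilde P ((2 * Real.pi) • ξ) ^ 2)
      (Bornology.cobounded (Space n)) atTop :=
    (tendsto_pow_atTop two_ne_zero).comp (hP.comp hscale)
  have hsq : Tendsto (fun k => ‖toL2 (φ k)‖ ^ 2) atTop (𝓝 0) := by
    simp only [norm_toL2_sq]
    refine tendsto_integral_zero_of_weight 0 (C := |K| * M ^ 2) hW (fun ξ => sq_nonneg _)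
      (fun k ξ => sq_nonneg _) (fun k => integrable_norm_fourier_sq (φ k))
      (fun k => integrable_symbolTilde_sq_mul_norm_fourier_sq P (φ k))
      (fun k => (hK (φ k)).trans ?_) (tendsto_setIntegral_norm_fourier_sq hφ)
    gcongr
    exacts [le_abs_self K, hM k]
  rw [tendsto_zero_iff_norm_tendsto_zero]
  simpa only [Real.sqrt_sq (norm_nonneg _), Real.sqrt_zero] using hsq.sqrt

end Embedding

/-! ### Weak solutions and the minimal operator -/

section WeakDiffOp

open scoped FourierTransform InnerProductSpace ComplexConjugate

variable {n : ℕ} {P : MvPolynomial (Fin n) ℝ} {Ω : Opens (Space n)} {u v f g : Space n → ℂ}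

/-- The complex conjugate of a test function. -/
def conjTest (φ : 𝓓(Ω, ℂ)) : 𝓓(Ω, ℂ) :=
  TestFunction.postcompCLM (𝕜 := ℝ) (Complex.conjCLE : ℂ →L[ℝ] ℂ) φ

theorem conjTest_apply (φ : 𝓓(Ω, ℂ)) (x : Space n) : conjTest φ x = conj (φ x) := rfl

theorem fourier_conjTest (φ : 𝓓(Ω, ℂ)) (ξ : Space n) :
    𝓕 (toSchwartz (conjTest φ)) ξ = conj (𝓕 (toSchwartz φ) (-ξ)) := by
  rw [SchwartzMap.fourier_coe, SchwartzMap.fourier_coe, Real.fourier_eq, Real.fourier_eq,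
    ← integral_conj]
  refine integral_congr_ae (ae_of_all _ fun x => ?_)
  simp only [toSchwartz_apply, conjTest_apply, Circle.smul_def, smul_eq_mul, map_mul,
    inner_neg_right, neg_neg, ← Circle.coe_inv_eq_conj, ← AddChar.map_neg_eq_inv]

theorem diffOpTranspose_conjTest (P : MvPolynomial (Fin n) ℝ) (φ : 𝓓(Ω, ℂ)) :
    diffOpTranspose P (conjTest φ) = conjTest (diffOp P φ) :=
  ext_fourier fun ξ => by
    rw [fourier_diffOpTranspose, fourier_conjTest, fourier_conjTest, fourier_diffOp, map_mul,
      Complex.conj_ofReal]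

theorem memL2Loc_of_memLp (hu : MemLp u 2 (volume.restrict (Ω : Set (Space n)))) :
    MemL2Loc Ω u := fun _ _ hK => hu.mono_measure (Measure.restrict_mono hK le_rfl)

namespace MemL2Loc

theorem sub (hu : MemL2Loc Ω u) (hv : MemL2Loc Ω v) : MemL2Loc Ω (u - v) :=
  fun K hK hKΩ => (hu K hK hKΩ).sub (hv K hK hKΩ)

theorem const_mul (hu : MemL2Loc Ω u) (c : ℂ) : MemL2Loc Ω fun x => c * u x :=
  fun K hK hKΩ => (hu K hK hKΩ).const_mul c

theorem bounded_mul {q : Space n → ℝ} (hq : MemLp q ∞ (volume.restrict (Ω : Set (Space n))))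
    (hu : MemL2Loc Ω u) : MemL2Loc Ω fun x => (q x : ℂ) * u x := fun K hK hKΩ =>
  (hu K hK hKΩ).mul (r := 2) ((hq.mono_measure (Measure.restrict_mono hKΩ le_rfl)).ofReal (K := ℂ))

theorem integrableOn_inner (hu : MemL2Loc Ω u) (φ : 𝓓(Ω, ℂ)) :
    IntegrableOn (fun x => ⟪φ x, u x⟫_ℂ) Ω := by
  have hK : IsCompact (tsupport φ) := φ.hasCompactSupport
  have hφ : MemLp φ 2 (volume.restrict (tsupport φ)) :=
    (memLp_testFunction φ).mono_measure (Measure.restrict_mono φ.tsupport_subset le_rfl)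
  have hinner : IntegrableOn (fun x => ⟪φ x, u x⟫_ℂ) (tsupport φ) :=
    (hu _ hK φ.tsupport_subset).integrable_mul hφ.star
  refine hinner.of_forall_sdiff_eq_zero Ω.isOpen.measurableSet fun x hx => ?_
  rw [image_eq_zero_of_notMem_tsupport hx.2, inner_zero_left]

end MemL2Loc

/-- `P(D)u = f` in the sense of distributions on `Ω`. As the coefficients of `P` are real, testing
against `φ̄` puts `P(D)` itself, rather than its transpose, on the test function. -/
def HasWeakDiffOp (P : MvPolynomial (Fin n) ℝ) (Ω : Opens (Space n)) (u f : Space n → ℂ) : Prop :=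
  ∀ φ : 𝓓(Ω, ℂ), ∫ x in (Ω : Set (Space n)), ⟪diffOp P φ x, u x⟫_ℂ
    = ∫ x in (Ω : Set (Space n)), ⟪φ x, f x⟫_ℂ

theorem WeakSolution.hasWeakDiffOp {lam : ℂ} {q : Space n → ℝ}
    (hq : MemLp q ∞ (volume.restrict (Ω : Set (Space n)))) (hu : MemL2Loc Ω u)
    (h : WeakSolution P Ω lam q u) : HasWeakDiffOp P Ω u fun x => lam * (q x * u x) := by
  intro φ
  rw [← sub_eq_zero, ← integral_sub (hu.integrableOn_inner _)
    (((hu.bounded_mul hq).const_mul lam).integrableOn_inner φ), ← h (conjTest φ)]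
  congr 1 with x
  rw [diffOpTranspose_conjTest, conjTest_apply, conjTest_apply, RCLike.inner_apply,
    RCLike.inner_apply]
  ring

namespace HasWeakDiffOp

theorem sub (hu : MemL2Loc Ω u) (hv : MemL2Loc Ω v) (hf : MemL2Loc Ω f) (hg : MemL2Loc Ω g)
    (huf : HasWeakDiffOp P Ω u f) (hvg : HasWeakDiffOp P Ω v g) :
    HasWeakDiffOp P Ω (u - v) (f - g) := fun φ => by
  simp only [Pi.sub_apply, inner_sub_right]
  rw [integral_sub (hu.integrableOn_inner _) (hv.integrableOn_inner _),
    integral_sub (hf.integrableOn_inner _) (hg.integrableOn_inner _), huf φ, hvg φ]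

theorem const_mul (huf : HasWeakDiffOp P Ω u f) (c : ℂ) :
    HasWeakDiffOp P Ω (fun x => c * u x) fun x => c * f x := fun φ => by
  have hinner : ∀ a b : ℂ, ⟪a, c * b⟫_ℂ = c * ⟪a, b⟫_ℂ := fun a b => inner_smul_right a b c
  simp only [hinner, integral_const_mul, huf φ]

theorem congr (huf : HasWeakDiffOp P Ω u f) (huv : u =ᵐ[volume.restrict (Ω : Set (Space n))] v)
    (hfg : f =ᵐ[volume.restrict (Ω : Set (Space n))] g) : HasWeakDiffOp P Ω v g := fun φ => by
  calc ∫ x in (Ω : Set (Space n)), ⟪diffOp P φ x, v x⟫_ℂ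
      = ∫ x in (Ω : Set (Space n)), ⟪diffOp P φ x, u x⟫_ℂ :=
        integral_congr_ae (huv.mono fun x hx => by simp only [hx])
    _ = ∫ x in (Ω : Set (Space n)), ⟪φ x, f x⟫_ℂ := huf φ
    _ = ∫ x in (Ω : Set (Space n)), ⟪φ x, g x⟫_ℂ :=
        integral_congr_ae (hfg.mono fun x hx => by simp only [hx])

theorem ae_eq (hf : MemL2Loc Ω f) (hg : MemL2Loc Ω g) (huf : HasWeakDiffOp P Ω u f)
    (hug : HasWeakDiffOp P Ω u g) : f =ᵐ[volume.restrict (Ω : Set (Space n))] g := by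
  have hloc : LocallyIntegrableOn (f - g) Ω := by
    rw [locallyIntegrableOn_iff Ω.isOpen.isLocallyClosed]
    intro K hKΩ hK
    have : IsFiniteMeasure (volume.restrict K) := ⟨by simpa using hK.measure_lt_top⟩
    exact (hf.sub hg K hK hKΩ).integrable one_le_two
  have hzero : ∀ φ : 𝓓(Ω, ℂ), ∫ x in (Ω : Set (Space n)), ⟪φ x, (f - g) x⟫_ℂ = 0 := fun φ => by
    simp only [Pi.sub_apply, inner_sub_right]
    rw [integral_sub (hf.integrableOn_inner φ) (hg.integrableOn_inner φ), ← huf φ, ← hug φ,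
      sub_self]
  have hae := Ω.isOpen.ae_eq_zero_of_integral_contDiff_smul_eq_zero hloc fun ρ hρ hc hs => by
    let φ : 𝓓(Ω, ℂ) := ⟨fun x => (ρ x : ℂ), Complex.ofRealCLM.contDiff.comp hρ,
      hc.comp_left Complex.ofReal_zero, (tsupport_comp_subset Complex.ofReal_zero ρ).trans hs⟩
    have hφ : ∀ x, ρ x • (f - g) x = ⟪φ x, (f - g) x⟫_ℂ := fun x => by
      rw [RCLike.inner_apply, Complex.real_smul, mul_comm]
      exact congrArg ((f - g) x * ·) (Complex.conj_ofReal (ρ x)).symm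
    calc ∫ x, ρ x • (f - g) x = ∫ x, ⟪φ x, (f - g) x⟫_ℂ := by simp only [hφ]
      _ = ∫ x in (Ω : Set (Space n)), ⟪φ x, (f - g) x⟫_ℂ :=
        (setIntegral_eq_integral_of_forall_compl_eq_zero fun x hx => by
          rw [Function.notMem_support.1 fun h => hx (support_testFunction_subset φ h),
            inner_zero_left]).symm
      _ = 0 := hzero φ
  refine (ae_restrict_iff' Ω.isOpen.measurableSet).2 (hae.mono fun x hx hxΩ => ?_)
  exact sub_eq_zero.1 (hx hxΩ)

end HasWeakDiffOp

theorem inner_toL2_eq_setIntegral (φ : 𝓓(Ω, ℂ)) (h : L2 Ω) :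
    ⟪toL2 φ, h⟫_ℂ = ∫ x in (Ω : Set (Space n)), ⟪φ x, h x⟫_ℂ := by
  rw [L2.inner_def]
  exact integral_congr_ae ((coeFn_toL2 φ).mono fun x hx => by simp only [hx])

theorem hasWeakDiffOp_iff_inner {u f : L2 Ω} :
    HasWeakDiffOp P Ω u f ↔ ∀ φ : 𝓓(Ω, ℂ), ⟪toL2 (diffOp P φ), u⟫_ℂ = ⟪toL2 φ, f⟫_ℂ := by
  simp only [HasWeakDiffOp, inner_toL2_eq_setIntegral]

end WeakDiffOp

section MinimalOperator

open scoped InnerProductSpace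

variable {n : ℕ} {P : MvPolynomial (Fin n) ℝ} {Ω : Opens (Space n)}

/-- The closure of `P(D)C_0^∞(Ω)` in `L²(Ω)`; it is the range of the minimal operator of `P(D)`,
and hence `H^P_0(Ω)` with the norm `‖P(D)u‖`. -/
abbrev diffOpRange (P : MvPolynomial (Fin n) ℝ) (Ω : Opens (Space n)) : Submodule ℂ (L2 Ω) :=
  (LinearMap.range (toL2 ∘ₗ diffOpLin P : 𝓓(Ω, ℂ) →ₗ[ℂ] L2 Ω)).topologicalClosure

/-- The map `φ ↦ P(D)φ` from the test functions to the range of the minimal operator. -/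
def toDiffOpRange (P : MvPolynomial (Fin n) ℝ) : 𝓓(Ω, ℂ) →ₗ[ℂ] diffOpRange P Ω :=
  (toL2 ∘ₗ diffOpLin P).codRestrict _ fun φ => subset_closure (LinearMap.mem_range_self _ φ)

theorem coe_toDiffOpRange (φ : 𝓓(Ω, ℂ)) :
    (toDiffOpRange P φ : L2 Ω) = toL2 (diffOp P φ) := rfl

theorem norm_toDiffOpRange (φ : 𝓓(Ω, ℂ)) : ‖toDiffOpRange P φ‖ = ‖toL2 (diffOp P φ)‖ := rfl

theorem denseRange_toDiffOpRange : DenseRange (toDiffOpRange (Ω := Ω) P) := by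
  rw [DenseRange, Subtype.dense_iff, ← Set.range_comp]
  exact fun f hf => hf

/-- The inverse of the minimal operator of `P(D)`: the continuous extension of `P(D)φ ↦ φ`, which is
zero by convention if there is no bound `‖φ‖ ≤ C ‖P(D)φ‖`. -/
def diffOpInv (P : MvPolynomial (Fin n) ℝ) (Ω : Opens (Space n)) : diffOpRange P Ω →L[ℂ] L2 Ω :=
  toL2.extendOfNorm (toDiffOpRange P)

theorem norm_toL2_le (φ : 𝓓(Ω, ℂ)) : ‖toL2 φ‖ ≤ (eLpNorm φ 2 volume).toReal := by
  rw [Lp.norm_def, eLpNorm_congr_ae (coeFn_toL2 φ)]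
  exact ENNReal.toReal_mono
    (φ.continuous.memLp_of_hasCompactSupport φ.hasCompactSupport).eLpNorm_ne_top
    (eLpNorm_mono_measure _ Measure.restrict_le_self)

variable (hΩ : Bornology.IsBounded (Ω : Set (Space n)))

include hΩ

theorem diffOpInv_toDiffOpRange (hP : P ≠ 0) (φ : 𝓓(Ω, ℂ)) :
    diffOpInv P Ω (toDiffOpRange P φ) = toL2 φ := by
  obtain ⟨K, hK⟩ := Asymptotics.isBigO_top.1 (isWeaker_one hΩ hP)
  refine LinearMap.extendOfNorm_eq denseRange_toDiffOpRange ⟨K, fun ψ => ?_⟩ φ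
  simpa only [diffOp_one, norm_toDiffOpRange] using hK ψ

theorem completelyContinuous_diffOpInv (hP : P ≠ 0)
    (hPtilde : Tendsto (symbolTilde P) (Bornology.cobounded (Space n)) atTop) :
    CompletelyContinuous (diffOpInv P Ω) :=
  .of_denseRange denseRange_toDiffOpRange fun φ hφ => by
    obtain ⟨M, hM⟩ := hφ.exists_norm_le
    have hweak := hφ.map (diffOpInv P Ω)
    simp only [diffOpInv_toDiffOpRange hΩ hP] at hweak ⊢
    exact tendsto_toL2_zero hΩ hPtilde hM hweak

theorem hasWeakDiffOp_diffOpInv (hP : P ≠ 0) (f : diffOpRange P Ω) :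
    HasWeakDiffOp P Ω (diffOpInv P Ω f) (f : L2 Ω) := by
  refine hasWeakDiffOp_iff_inner.2 fun φ => ?_
  induction f using denseRange_toDiffOpRange.induction_on with
  | hp => exact isClosed_eq (by fun_prop) (by fun_prop)
  | ih ψ => rw [diffOpInv_toDiffOpRange hΩ hP, inner_diffOp, coe_toDiffOpRange]

theorem MemH0.exists_ae_eq_diffOpInv (hP : P ≠ 0) {u : Space n → ℂ} (hu : MemH0 P Ω u) :
    ∃ f, u =ᵐ[volume.restrict (Ω : Set (Space n))] diffOpInv P Ω f := by
  obtain ⟨hu₂, φ, hPφ, hφ⟩ := hu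
  have hcauchy : CauchySeq fun k => toDiffOpRange P (φ k) := by
    rw [cauchySeq_iff_tendsto_dist_atTop_0]
    refine squeeze_zero (fun _ => dist_nonneg) (fun p => ?_)
      ((ENNReal.tendsto_toReal ENNReal.zero_ne_top).comp hPφ)
    rw [dist_eq_norm, ← map_sub, norm_toDiffOpRange]
    exact norm_toL2_le _
  obtain ⟨f, hf⟩ := cauchySeq_tendsto_of_complete hcauchy
  have hlim : Tendsto (fun k => toL2 (φ k)) atTop (𝓝 (diffOpInv P Ω f)) := by
    simpa only [Function.comp_def, diffOpInv_toDiffOpRange hΩ hP] using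
      ((diffOpInv P Ω).continuous.tendsto f).comp hf
  have hlim' : Tendsto (fun k => toL2 (φ k)) atTop (𝓝 hu₂.toLp) :=
    (Lp.tendsto_Lp_iff_tendsto_eLpNorm'' _ (fun k => memLp_testFunction (φ k)) u hu₂).2 hφ
  exact ⟨f, tendsto_nhds_unique hlim hlim' ▸ hu₂.coeFn_toLp.symm⟩

end MinimalOperator

/-! ### The transmission problem -/

section Multiplication

open scoped InnerProductSpace

variable {α : Type*} [MeasurableSpace α] {μ : Measure α} {m : α → ℝ}

/-- Multiplication by the bounded real function `m` as an operator on `L²(μ)`. -/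
def mulOp (hm : MemLp m ∞ μ) : Lp ℂ 2 μ →L[ℂ] Lp ℂ 2 μ :=
  (ContinuousLinearMap.mul ℂ ℂ).holderL μ ∞ 2 2 (hm.ofReal (K := ℂ)).toLp

theorem coeFn_mulOp (hm : MemLp m ∞ μ) (f : Lp ℂ 2 μ) :
    mulOp hm f =ᵐ[μ] fun x => (m x : ℂ) * f x := by
  have hmul : mulOp hm f =ᵐ[μ] fun x => (hm.ofReal (K := ℂ)).toLp _ x * f x :=
    (ContinuousLinearMap.mul ℂ ℂ).coeFn_holder (r := 2) (hm.ofReal (K := ℂ)).toLp f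
  filter_upwards [hmul, (hm.ofReal (K := ℂ)).coeFn_toLp] with x hx hmx
  rw [hx, hmx]
  rfl

theorem mul_norm_sq_le_norm_inner_mulOp (hm : MemLp m ∞ μ) {c : ℝ} (hc : ∀ᵐ x ∂μ, c ≤ m x)
    (f : Lp ℂ 2 μ) : c * ‖f‖ ^ 2 ≤ ‖⟪mulOp hm f, f⟫_ℂ‖ := by
  have hintegral : ⟪mulOp hm f - (c : ℂ) • f, f⟫_ℂ
      = (∫ x, (m x - c) * ‖f x‖ ^ 2 ∂μ : ℝ) := by
    rw [L2.inner_def, ← integral_complex_ofReal]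
    refine integral_congr_ae ?_
    filter_upwards [Lp.coeFn_sub (mulOp hm f) ((c : ℂ) • f), Lp.coeFn_smul (c : ℂ) f,
      coeFn_mulOp hm f] with x hsub hsmul hmul
    rw [hsub, Pi.sub_apply, hsmul, hmul, Pi.smul_apply, smul_eq_mul, ← sub_mul,
      ← Complex.ofReal_sub, ← smul_eq_mul, inner_smul_left, inner_self_eq_norm_sq_to_K]
    simp only [Complex.conj_ofReal, Complex.coe_algebraMap, Complex.ofReal_mul, Complex.ofReal_pow]
  have hnonneg : 0 ≤ ∫ x, (m x - c) * ‖f x‖ ^ 2 ∂μ :=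
    integral_nonneg_of_ae (hc.mono fun x hx => mul_nonneg (sub_nonneg.2 hx) (sq_nonneg _))
  have hself : (⟪f, f⟫_ℂ).re = ‖f‖ ^ 2 := inner_self_eq_norm_sq (𝕜 := ℂ) f
  have hre := congrArg Complex.re hintegral
  rw [inner_sub_left, inner_smul_left, Complex.conj_ofReal, Complex.sub_re, Complex.ofReal_re,
    Complex.re_ofReal_mul, hself] at hre
  linarith [Complex.re_le_norm ⟪mulOp hm f, f⟫_ℂ]

theorem memLp_top_inv {δ : ℝ} (hδ : 0 < δ) (hm : AEStronglyMeasurable m μ)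
    (hmδ : ∀ᵐ x ∂μ, δ ≤ m x) : MemLp m⁻¹ ∞ μ := by
  refine memLp_top_of_bound hm.aemeasurable.inv.aestronglyMeasurable δ⁻¹ (hmδ.mono fun x hx => ?_)
  rw [Pi.inv_apply, Real.norm_of_nonneg (inv_nonneg.2 (hδ.le.trans hx))]
  exact inv_anti₀ hδ hx

theorem exists_pos_le_inv {δ : ℝ} (hδ : 0 < δ) (hm : MemLp m ∞ μ) (hmδ : ∀ᵐ x ∂μ, δ ≤ m x) :
    ∃ c > 0, ∀ᵐ x ∂μ, c ≤ m⁻¹ x := by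
  obtain ⟨C, hC⟩ := eLpNormEssSup_lt_top_iff_isBoundedUnder.1
    (eLpNorm_exponent_top (f := m) (μ := μ) ▸ hm.eLpNorm_lt_top)
  refine ⟨(C + 1 : ℝ)⁻¹, by positivity, ?_⟩
  filter_upwards [hmδ, eventually_map.1 hC] with x hx hxC
  have hxC' : ‖m x‖ ≤ C := hxC
  exact inv_anti₀ (hδ.trans_le hx) (((le_abs_self _).trans hxC').trans (by linarith))

end Multiplication

section Transmission

open scoped InnerProductSpace

variable {n : ℕ} {P : MvPolynomial (Fin n) ℝ} {Ω : Opens (Space n)} {V : Space n → ℝ} {lam : ℂ}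
  (hΩ : Bornology.IsBounded (Ω : Set (Space n))) (hP : P ≠ 0)
  (hV : MemLp V ∞ (volume.restrict (Ω : Set (Space n))))

include hΩ hP in
theorem HasWeakDiffOp.adjoint_eq {u f : L2 Ω} (h : HasWeakDiffOp P Ω u f) :
    ContinuousLinearMap.adjoint (diffOpRange P Ω).subtypeL u
      = ContinuousLinearMap.adjoint (diffOpInv P Ω) f := by
  refine ext_inner_left ℂ fun g => ?_
  rw [ContinuousLinearMap.adjoint_inner_right, ContinuousLinearMap.adjoint_inner_right]
  induction g using denseRange_toDiffOpRange.induction_on with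
  | hp => exact isClosed_eq (by fun_prop) (by fun_prop)
  | ih φ =>
    rw [diffOpInv_toDiffOpRange hΩ hP]
    exact hasWeakDiffOp_iff_inner.1 h φ

include hΩ hP hV

theorem exists_sub_smul_diffOpInv_ae_eq {v w : Space n → ℂ} (hv : MemL2Loc Ω v)
    (hw : MemL2Loc Ω w) (hvs : WeakSolution P Ω lam (fun _ => 1) v)
    (hws : WeakSolution P Ω lam (fun x => 1 + V x) w) (hvw : MemH0 P Ω (v - w)) :
    ∃ f, ⇑(((diffOpRange P Ω).subtypeL - lam • diffOpInv P Ω) f)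
      =ᵐ[volume.restrict (Ω : Set (Space n))] fun x => -lam * (V x * w x) := by
  obtain ⟨f, hf⟩ := hvw.exists_ae_eq_diffOpInv hΩ hP
  have hone : MemLp (fun _ : Space n => (1 : ℝ)) ∞ (volume.restrict (Ω : Set (Space n))) :=
    memLp_top_const 1
  have hq := hone.add hV
  have hf' : HasWeakDiffOp P Ω (v - w) (f : L2 Ω) :=
    HasWeakDiffOp.congr (hasWeakDiffOp_diffOpInv hΩ hP f) hf.symm .rfl
  have hsub : HasWeakDiffOp P Ω (v - w) _ :=
    .sub hv hw ((hv.bounded_mul hone).const_mul lam) ((hw.bounded_mul hq).const_mul lam)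
      (hvs.hasWeakDiffOp hone hv) (hws.hasWeakDiffOp hq hw)
  have hae := hf'.ae_eq (memL2Loc_of_memLp (Lp.memLp _))
    (((hv.bounded_mul hone).const_mul lam).sub ((hw.bounded_mul hq).const_mul lam)) hsub
  refine ⟨f, ?_⟩
  filter_upwards [hf, hae, Lp.coeFn_sub (f : L2 Ω) (lam • diffOpInv P Ω f),
    Lp.coeFn_smul lam (diffOpInv P Ω f)] with x hux hfx hsubx hsmulx
  have hx : (((diffOpRange P Ω).subtypeL - lam • diffOpInv P Ω) f : L2 Ω) x
      = (f : L2 Ω) x - lam * diffOpInv P Ω f x :=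
    hsubx.trans (by rw [Pi.sub_apply, hsmulx, Pi.smul_apply, smul_eq_mul])
  rw [hx, hfx, ← hux]
  simp only [Pi.sub_apply, Pi.add_apply, Complex.ofReal_add, Complex.ofReal_one]
  ring

/-- The function `V⁻¹(P(D) - λ)u` with `u = v - w` is a multiple of `w`. -/
theorem IsTransmissionEigenvalue.exists_pencil_eigenvector
    (hV' : MemLp V⁻¹ ∞ (volume.restrict (Ω : Set (Space n))))
    (hq : MemLp (fun x => 1 + V x) ∞ (volume.restrict (Ω : Set (Space n))))
    (hV₀ : ∀ᵐ x ∂volume.restrict (Ω : Set (Space n)), V x ≠ 0) (hlam : lam ≠ 0)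
    (h : IsTransmissionEigenvalue P Ω V lam) :
    ∃ f : diffOpRange P Ω, f ≠ 0 ∧
      (ContinuousLinearMap.adjoint (diffOpRange P Ω).subtypeL ∘L mulOp hV'
          - lam • (ContinuousLinearMap.adjoint (diffOpInv P Ω) ∘L mulOp hq ∘L mulOp hV'))
        (((diffOpRange P Ω).subtypeL - lam • diffOpInv P Ω) f) = 0 := by
  obtain ⟨v, w, hv, hw, -, hw₀, hvs, hws, hvw⟩ := h
  obtain ⟨f, hf⟩ := exists_sub_smul_diffOpInv_ae_eq hΩ hP hV hv hw hvs hws hvw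
  set W := mulOp hV' (((diffOpRange P Ω).subtypeL - lam • diffOpInv P Ω) f) with hW_def
  have hW : W =ᵐ[volume.restrict (Ω : Set (Space n))] fun x => -lam * w x := by
    filter_upwards [coeFn_mulOp hV' _, hf, hV₀] with x hx hfx hVx
    have hVx' : (V x : ℂ) ≠ 0 := Complex.ofReal_ne_zero.2 hVx
    rw [hW_def, hx, hfx, Pi.inv_apply, Complex.ofReal_inv]
    field_simp
  have hWweak : HasWeakDiffOp P Ω W (lam • mulOp hq W : L2 Ω) := by
    refine HasWeakDiffOp.congr (HasWeakDiffOp.const_mul (hws.hasWeakDiffOp hq hw) (-lam)) hW.symm ?_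
    filter_upwards [Lp.coeFn_smul lam (mulOp hq W), coeFn_mulOp hq W, hW] with x hx hqx hWx
    rw [hx, Pi.smul_apply, hqx, hWx, smul_eq_mul]
    ring
  refine ⟨f, ?_, ?_⟩
  · rintro rfl
    refine hw₀ ?_
    rw [map_zero, map_zero] at hW_def
    filter_upwards [hW, Lp.coeFn_zero ℂ 2 (volume.restrict (Ω : Set (Space n)))] with x hx h₀
    rw [hW_def, h₀] at hx
    exact (mul_eq_zero.1 hx.symm).resolve_left (neg_ne_zero.2 hlam)
  · rw [sub_apply, smul_apply, ContinuousLinearMap.comp_apply, ContinuousLinearMap.comp_apply,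
      ContinuousLinearMap.comp_apply, ← hW_def, hWweak.adjoint_eq hΩ hP, map_smul, sub_self]

theorem finite_isTransmissionEigenvalue_inter_closedBall {δ : ℝ} (hδ : 0 < δ)
    (hVδ : ∀ᵐ x ∂volume.restrict (Ω : Set (Space n)), δ ≤ V x)
    (hPtilde : Tendsto (symbolTilde P) (Bornology.cobounded (Space n)) atTop) (r : ℝ) :
    ({lam : ℂ | IsTransmissionEigenvalue P Ω V lam} ∩ Metric.closedBall 0 r).Finite := by
  have hV' := memLp_top_inv hδ hV.1 hVδ
  have hone : MemLp (fun _ : Space n => (1 : ℝ)) ∞ (volume.restrict (Ω : Set (Space n))) :=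
    memLp_top_const 1
  have hq := hone.add hV
  have hT := completelyContinuous_diffOpInv hΩ hP hPtilde
  obtain ⟨c, hc, hcV⟩ := exists_pos_le_inv hδ hV hVδ
  have hBJ := isUnit_adjoint_subtypeL_comp_comp hc (mul_norm_sq_le_norm_inner_mulOp hV' hcV)
    (diffOpRange P Ω)
  have hS := hT.adjoint.comp_right (mulOp hq ∘L mulOp hV')
  have hpencil := CompletelyContinuous.finite_factored_pencil hBJ hS hT r
  refine (hpencil.insert 0).subset fun lam ⟨hlam, hr⟩ => ?_
  rw [Set.mem_insert_iff, or_iff_not_imp_left]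
  exact fun hlam₀ => ⟨mem_closedBall_zero_iff.1 hr,
    hlam.exists_pencil_eigenvector hΩ hP hV hV' hq
      (hVδ.mono fun x hx => (hδ.trans_le hx).ne') hlam₀⟩

end Transmission

end Acoustic

end

theorem theorem6p1_general {n : ℕ} {P₀ : MvPolynomial (Fin n) ℝ} (hP₀ : P₀ ≠ 0)
    {Ω : Opens (Acoustic.Space n)} (hΩ : Bornology.IsBounded (Ω : Set (Acoustic.Space n)))
    {V : Acoustic.Space n → ℝ}
    (hV : MemLp V ∞ (volume.restrict (Ω : Set (Acoustic.Space n)))) {δ : ℝ} (hδ : 0 < δ)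
    (hVδ : ∀ᵐ x ∂volume.restrict (Ω : Set (Acoustic.Space n)), δ ≤ V x)
    (hP : Tendsto (Acoustic.symbolTilde P₀) (Bornology.cobounded (Acoustic.Space n)) atTop) :
    IsClosed {lam : ℂ | Acoustic.IsTransmissionEigenvalue P₀ Ω V lam} ∧
    IsDiscrete {lam : ℂ | Acoustic.IsTransmissionEigenvalue P₀ Ω V lam} :=
  Acoustic.isClosed_and_isDiscrete_of_finite_closedBall 0
    (Acoustic.finite_isTransmissionEigenvalue_inter_closedBall hΩ hP₀ hV hδ hVδ hP)

theorem theorem6p1 (n : ℕ) (P₀ : MvPolynomial (Fin n) ℝ) (hdeg : 2 ≤ P₀.totalDegree)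
    (Ω : Opens (Acoustic.Space n)) (hΩ : IsConnected (Ω : Set (Acoustic.Space n)))
    (hΩb : Bornology.IsBounded (Ω : Set (Acoustic.Space n)))
    (V : Acoustic.Space n → ℝ) (hV : MemLp V ∞ volume)
    (hVsupp : Acoustic.essSupport V = closure (Ω : Set (Acoustic.Space n)))
    (δ : ℝ) (hδ : 0 < δ)
    (hVδ : ∀ᵐ x ∂(volume.restrict (closure (Ω : Set (Acoustic.Space n)))), δ ≤ V x)
    (hP : Tendsto (Acoustic.symbolTilde P₀) (Bornology.cobounded (Acoustic.Space n)) atTop) :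
    IsClosed {lam : ℂ | Acoustic.IsTransmissionEigenvalue P₀ Ω V lam} ∧
    IsDiscrete {lam : ℂ | Acoustic.IsTransmissionEigenvalue P₀ Ω V lam} := by
  have hP₀ : P₀ ≠ 0 := by
    rintro rfl
    simp at hdeg
  exact theorem6p1_general hP₀ hΩb (hV.restrict _) hδ
    (ae_restrict_of_ae_restrict_of_subset subset_closure hVδ) hP
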